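/- **Vanishing exponent and eventual hyperbolic dimension.** Let $f\colon\mathbb{C}\to\mathbb{C}$ be a transcendental entire function in the Eremenko–Lyubich class $\mathcal{B}$, i.e. the closure $S(f)$ of the set of finite critical and asymptotic values of $f$ is bounded. Then $$\limsup_{\lambda\to 0}\operatorname{hypdim}(\lambda f)\le\theta(f)\qquad\text{and}\qquad \operatorname{edim}_{\mathrm{hyp}}(f)\le\theta(f),$$ where $\lambda$ ranges over $\mathbb{C}\setminus\{0\}$ and the following notation is used. A *hyperbolic set* of an entire function $g$ is a compact set $K\subset\mathbb{C}$ with $g(K)\subset K$ for which there are $n\ge 1$ and $c>1$ with $|(g^n)'(z)|\ge c$ for all $z\in K$, where $g^n$ is the $n$-th iterate. With $\operatorname{HD}$ denoting Hausdorff dimension, $$\operatorname{hypdim}(g)=\sup\{\operatorname{HD}(K): K\text{ is a hyperbolic set of }g\},$$ $$\operatorname{edim}_{\mathrm{hyp}}(g)=\lim_{R\to\infty}\sup\Big\{\operatorname{HD}(K): K\text{ is a hyperbolic set of }g\text{ with }\inf_{z\in K}|z|\ge R\Big\}.$$ The *vanishing exponent* of $f$ is $$\theta(f)=\inf\Big\{t\ge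 0:\ \limsup_{w\to\infty}\sum_{z\in f^{-1}(w)}\Big(\frac{|w|}{|z|\,|f'(z)|}\Big)^{t}=0\Big\}\in[0,+\infty],$$ with $\inf\emptyset=+\infty$; the sum is the cylindrical partition function of $f$ at $w$ with exponent $t$. -/

import Mathlib

open Filter Topology Set
open scoped NNReal ENNReal

noncomputable section

namespace EntireDynamics

/-- `f` is a transcendental entire function: entire, and not a polynomial. -/
def IsTranscendentalEntire (f : ℂ → ℂ) : Prop :=
  Differentiable ℂ f ∧ ¬ ∃ p : Polynomial ℂ, ∀ z, f z = p.eval z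

/-- The set of (finite) critical values of `f`. -/
def criticalValues (f : ℂ → ℂ) : Set ℂ :=
  {a | ∃ z, deriv f z = 0 ∧ f z = a}

/-- The set of (finite) asymptotic values of `f`: the limits of `f` along curves that tend to
infinity. -/
def asymptoticValues (f : ℂ → ℂ) : Set ℂ :=
  {a | ∃ γ : ℝ → ℂ, ContinuousOn γ (Ici 0) ∧ Tendsto γ atTop (Bornology.cobounded ℂ) ∧
    Tendsto (fun s => f (γ s)) atTop (𝓝 a)}

/-- The singular set `S(f)`. -/
def singularSet (f : ℂ → ℂ) : Set ℂ :=
  closure (criticalValues f ∪ asymptoticValues f)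

/-- The Eremenko-Lyubich class `𝓑`. -/
def ClassB (f : ℂ → ℂ) : Prop :=
  IsTranscendentalEntire f ∧ Bornology.IsBounded (singularSet f)

/-- `K` is a hyperbolic set of `f`: compact, forward invariant and uniformly expanding. -/
def IsHyperbolicSet (f : ℂ → ℂ) (K : Set ℂ) : Prop :=
  IsCompact K ∧ MapsTo f K K ∧
    ∃ n : ℕ, 1 ≤ n ∧ ∃ c : ℝ, 1 < c ∧ ∀ z ∈ K, c ≤ ‖deriv (f^[n]) z‖

/-- The hyperbolic dimension of `f`. -/
def hypdim (f : ℂ → ℂ) : ℝ≥0∞ :=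
  ⨆ (K : Set ℂ) (_ : IsHyperbolicSet f K), dimH K

/-- The supremum of the dimensions of the hyperbolic sets `K` of `f` with `inf_{z ∈ K} |z| ≥ R`. -/
def hypdimOutside (f : ℂ → ℂ) (R : ℝ) : ℝ≥0∞ :=
  ⨆ (K : Set ℂ) (_ : IsHyperbolicSet f K ∧ ∀ z ∈ K, R ≤ ‖z‖), dimH K

/-- The eventual hyperbolic dimension of `f`, the limit of `hypdimOutside f R` as `R → ∞`
(the limit exists, see `tendsto_hypdimOutside`). -/
def edimHyp (f : ℂ → ℂ) : ℝ≥0∞ :=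
  limsup (hypdimOutside f) atTop

theorem antitone_hypdimOutside (f : ℂ → ℂ) : Antitone (hypdimOutside f) := by
  intro R S hRS
  refine iSup₂_le fun K hK => ?_
  exact le_iSup₂ (f := fun (K : Set ℂ) (_ : IsHyperbolicSet f K ∧ ∀ z ∈ K, R ≤ ‖z‖) => dimH K)
    K ⟨hK.1, fun z hz => hRS.trans (hK.2 z hz)⟩

theorem tendsto_hypdimOutside (f : ℂ → ℂ) :
    Tendsto (hypdimOutside f) atTop (𝓝 (edimHyp f)) := by
  have h := tendsto_atTop_iInf (antitone_hypdimOutside f)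
  have e : edimHyp f = ⨅ R, hypdimOutside f R := h.limsup_eq
  rwa [e]

/-- The cylindrical partition function: the sum over all `z` with `f z = w` of
`(|w| / (|z| |f'(z)|)) ^ t`, that is, of the `-t`-th power of the norm of the derivative of `f`
at `z` with respect to the metric `|dz| / |z|`. The sum is taken in `[0, ∞]`. -/
def cylPartition (t : ℝ) (f : ℂ → ℂ) (w : ℂ) : ℝ≥0∞ :=
  ∑' z : f ⁻¹' {w}, (‖w‖ₑ / (‖(z : ℂ)‖ₑ * ‖deriv f z‖ₑ)) ^ t

/-- The vanishing exponent of `f`, an element of `[0, ∞]`. -/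
def vanishingExponent (f : ℂ → ℂ) : ℝ≥0∞ :=
  ⨅ (t : ℝ≥0) (_ : limsup (cylPartition t f) (Bornology.cobounded ℂ) = 0), (t : ℝ≥0∞)

end EntireDynamics

end

namespace EntireDynamics

open MeasureTheory Metric

/-! The partition function sums `-t`-th powers of derivatives in the metric `|dz| / |z|`. If `t` is
admissible in `vanishingExponent`, it is at most `1 / 2` far out, and by the chain rule so is its
analogue for `g^[n]` along orbits staying far out (`tsum_iterate_le`). On a hyperbolic set `K` lying
there, pulling a small set back under the expanding `g^[n]` does not increase the sum of `t`-th
powers of cylindrical diameters: the `1 / 2` absorbs the distortion. Iterating gives ever finer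
covers of `K` with bounded sums, so `dimH K ≤ t` (`dimH_le_of_preimage_sum_le`). For `c * f` with
`c` small, "far out" means outside the unit disc, since its partition function at `w` is that of `f`
at `w / c`; hyperbolic sets avoid this disc because it is mapped well inside itself. -/

/-! ### Hausdorff measure bounds from iterated pull-backs. -/

theorem pre_iterate_preimage_le {X : Type*} [EMetricSpace X] {K : Set X} {G : X → X}
    (hG : MapsTo G K K) {t : ℝ} (ht : 0 ≤ t) {θ d : ℝ≥0∞} (hθ : θ ≤ 1) {ρ : X → ℝ≥0∞}
    (hρ : ∀ w ∈ K, 1 ≤ ρ w)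
    (H : ∀ E ⊆ K, ∀ w ∈ E, ediam E ≤ d →
      ∃ (ι : Type) (_ : Countable ι) (F : ι → Set X) (b : ι → X),
      (∀ i, b i ∈ F i ∧ F i ⊆ K ∧ ediam (F i) ≤ θ * ediam E) ∧ K ∩ G ⁻¹' E ⊆ ⋃ i, F i ∧
      ∑' i, (ρ (b i) * ediam (F i)) ^ t ≤ (ρ w * ediam E) ^ t) (k : ℕ) :
    ∀ E ⊆ K, ∀ w ∈ E, ediam E ≤ d →
      OuterMeasure.mkMetric'.pre (fun s : Set X => ediam s ^ t) (θ ^ k * ediam E)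
        (K ∩ G^[k] ⁻¹' E) ≤ (ρ w * ediam E) ^ t := by
  induction k with
  | zero =>
    intro E hE w hw _
    have h1 : K ∩ G^[0] ⁻¹' E = E := by
      simpa using hE
    rw [h1, pow_zero, one_mul]
    refine (OuterMeasure.mkMetric'.pre_le le_rfl).trans ?_
    refine ENNReal.rpow_le_rpow ?_ ht
    exact le_mul_of_one_le_left' (hρ w (hE hw))
  | succ k ih =>
    intro E hE w hw hd
    obtain ⟨ι, _, F, b, hF, hcov, hsum⟩ := H E hE w hw hd
    have hsub : K ∩ G^[k + 1] ⁻¹' E ⊆ ⋃ i, K ∩ G^[k] ⁻¹' (F i) := by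
      rintro z ⟨hzK, hz⟩
      rw [mem_preimage, Function.iterate_succ_apply'] at hz
      obtain ⟨i, hi⟩ := mem_iUnion.1 (hcov ⟨hG.iterate k hzK, hz⟩)
      exact mem_iUnion.2 ⟨i, hzK, hi⟩
    refine (measure_mono hsub).trans ((measure_iUnion_le _).trans (le_trans ?_ hsum))
    refine ENNReal.tsum_le_tsum fun i => ?_
    obtain ⟨hb, hFK, hFd⟩ := hF i
    have hFd' : ediam (F i) ≤ d :=
      hFd.trans ((mul_le_of_le_one_left' hθ).trans hd)
    refine le_trans (OuterMeasure.mkMetric'.mono_pre _ ?_ _) (ih (F i) hFK (b i) hb hFd')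
    rw [pow_succ, mul_assoc]
    gcongr

/-- One finite cover of `K` by small sets, pulled back `k` times, gives covers at scale `θ ^ k * d`
whose cost is bounded independently of `k`. -/
theorem hausdorffMeasure_ne_top_of_pullback {X : Type*} [EMetricSpace X] [MeasurableSpace X]
    [BorelSpace X] {K : Set X} (hK : IsCompact K) {G : X → X}
    (hG : MapsTo G K K) {t : ℝ} (ht : 0 ≤ t) {θ d : ℝ≥0∞} (hθ : θ < 1) (hd : d ≠ 0) (hd' : d ≠ ∞)
    {ρ : X → ℝ≥0∞} (hρ : ∀ w ∈ K, 1 ≤ ρ w) (hρ' : ∀ w ∈ K, ρ w ≠ ∞)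
    (H : ∀ E ⊆ K, ∀ w ∈ E, ediam E ≤ d →
      ∃ (ι : Type) (_ : Countable ι) (F : ι → Set X) (b : ι → X),
      (∀ i, b i ∈ F i ∧ F i ⊆ K ∧ ediam (F i) ≤ θ * ediam E) ∧ K ∩ G ⁻¹' E ⊆ ⋃ i, F i ∧
      ∑' i, (ρ (b i) * ediam (F i)) ^ t ≤ (ρ w * ediam E) ^ t) :
    μH[t] K ≠ ∞ := by
  obtain ⟨T, hTK, hTcov⟩ := hK.elim_nhds_subcover (fun x => eball x (d / 2))
    (fun x _ => eball_mem_nhds x (ENNReal.half_pos hd))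
  set E : X → Set X := fun x => K ∩ eball x (d / 2)
  have hEd : ∀ x, ediam (E x) ≤ d := fun x =>
    (ediam_mono inter_subset_right).trans
      (ediam_eball_le.trans (ENNReal.mul_div_cancel (by simp) (by simp)).le)
  set C : ℝ≥0∞ := ∑ x ∈ T, (ρ x * d) ^ t
  have hC : C ≠ ∞ := by
    refine ENNReal.sum_ne_top.2 fun x hx => ?_
    exact ENNReal.rpow_ne_top_of_nonneg ht (ENNReal.mul_ne_top (hρ' x (hTK x hx)) hd')
  have key : ∀ k : ℕ,
      OuterMeasure.mkMetric'.pre (fun s : Set X => ediam s ^ t) (θ ^ k * d) K ≤ C := by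
    intro k
    have hsub : K ⊆ ⋃ x ∈ T, K ∩ G^[k] ⁻¹' (E x) := by
      intro z hz
      have h := hG.iterate k hz
      obtain ⟨x, hx, hzx⟩ := mem_iUnion₂.1 (hTcov h)
      exact mem_iUnion₂.2 ⟨x, hx, hz, h, hzx⟩
    refine (measure_mono hsub).trans ((measure_biUnion_finset_le _ _).trans ?_)
    refine Finset.sum_le_sum fun x hx => ?_
    have h := pre_iterate_preimage_le hG ht hθ.le hρ H k (E x) inter_subset_left x
      ⟨hTK x hx, mem_eball_self (ENNReal.half_pos hd)⟩ (hEd x)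
    refine (OuterMeasure.mkMetric'.mono_pre _ ?_ _).trans (h.trans ?_)
    · gcongr
      exact hEd x
    · gcongr
      exact hEd x
  have hle : μH[t] K ≤ C := by
    have h0 : μH[t] K = OuterMeasure.mkMetric' (fun s : Set X => ediam s ^ t) K := by
      rw [Measure.hausdorffMeasure, ← Measure.coe_toOuterMeasure, Measure.mkMetric_toOuterMeasure]
      rfl
    rw [h0, OuterMeasure.mkMetric']
    simp only [OuterMeasure.iSup_apply]
    refine iSup₂_le fun r hr => ?_
    have hlim : Tendsto (fun k : ℕ => θ ^ k * d) atTop (𝓝 0) := by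
      simpa using ENNReal.Tendsto.mul_const (ENNReal.tendsto_pow_atTop_nhds_zero_of_lt_one hθ)
        (Or.inr hd')
    obtain ⟨k, hk⟩ := (hlim.eventually_le_const hr).exists
    exact (OuterMeasure.mkMetric'.mono_pre _ hk _).trans (key k)
  exact ne_top_of_le_ne_top hC hle

/-! ### Distortion and the dimension bound for an expanding map. -/

/-- Strict differentiability gives the estimates near each point; a Lebesgue number makes the radius
uniform. -/
theorem exists_local_expansion {K U : Set ℂ} (hK : IsCompact K) (hU : IsOpen U) (hKU : K ⊆ U)
    {G : ℂ → ℂ} (hG : Differentiable ℂ G) (hG0 : ∀ z ∈ K, deriv G z ≠ 0) (hK0 : (0 : ℂ) ∉ K)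
    {s : ℝ} (hs : 1 < s) :
    ∃ δ > 0, ∀ z ∈ K, ∀ u ∈ ball z δ, ∀ x ∈ ball z δ, ∀ y ∈ ball z δ,
      u ∈ U ∧ deriv G u ≠ 0 ∧ ‖u‖ ≤ s * ‖x‖ ∧ ‖deriv G u‖ * ‖x - y‖ ≤ s * ‖G x - G y‖ := by
  have hcont : Continuous (deriv G) := (hG.contDiff (n := 2)).continuous_deriv (by norm_num)
  have hloc : ∀ z : K, ∃ r > 0, ∀ u ∈ ball (z : ℂ) r, ∀ x ∈ ball (z : ℂ) r, ∀ y ∈ ball (z : ℂ) r,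
      u ∈ U ∧ deriv G u ≠ 0 ∧ ‖u‖ ≤ s * ‖x‖ ∧ ‖deriv G u‖ * ‖x - y‖ ≤ s * ‖G x - G y‖ := by
    rintro ⟨z, hz⟩
    have hA : 0 < ‖deriv G z‖ := norm_pos_iff.2 (hG0 z hz)
    have hz0 : 0 < ‖z‖ := norm_pos_iff.2 fun h => hK0 (h ▸ hz)
    set A := ‖deriv G z‖
    have hs0 : 0 < s := by linarith
    obtain ⟨κ, hκ, hκ1⟩ : ∃ κ > 0, A + κ ≤ s * (A - κ) := by
      refine ⟨A * (s - 1) / (s + 1), by have := sub_pos.2 hs; positivity, le_of_eq ?_⟩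
      field_simp
      ring
    have hstrict : HasStrictDerivAt G (deriv G z) z :=
      (hG.analyticAt z).hasStrictDerivAt
    have h1 : ∀ᶠ p : ℂ × ℂ in 𝓝 z ×ˢ 𝓝 z,
        ‖G p.1 - G p.2 - deriv G z * (p.1 - p.2)‖ ≤ κ * ‖p.1 - p.2‖ := by
      have := hstrict.isLittleO.def hκ
      rw [← nhds_prod_eq]
      filter_upwards [this] with p hp
      simpa [mul_comm] using hp
    obtain ⟨r1, hr1, h1⟩ := (((nhds_basis_ball (x := z)).prod_self).eventually_iff).1 h1
    have h2 : ∀ᶠ u in 𝓝 z, u ∈ U ∧ deriv G u ≠ 0 ∧ ‖deriv G u‖ ≤ A + κ := by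
      refine Filter.Eventually.and (hU.mem_nhds (hKU hz))
        ((hcont.continuousAt.eventually_ne (hG0 z hz)).and ?_)
      exact (hcont.norm.continuousAt (x := z)).eventually_le_const (by simpa [A] using hκ)
    obtain ⟨r2, hr2, h2⟩ := (nhds_basis_ball.eventually_iff).1 h2
    have h3 : ∀ᶠ p : ℂ × ℂ in 𝓝 z ×ˢ 𝓝 z, ‖p.1‖ < s * ‖p.2‖ := by
      rw [← nhds_prod_eq]
      have c1 : ContinuousAt (fun p : ℂ × ℂ => ‖p.1‖) (z, z) := by fun_prop
      have c2 : ContinuousAt (fun p : ℂ × ℂ => s * ‖p.2‖) (z, z) := by fun_prop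
      exact c1.eventually_lt c2 (by nlinarith)
    obtain ⟨r3, hr3, h3⟩ := (((nhds_basis_ball (x := z)).prod_self).eventually_iff).1 h3
    refine ⟨min r1 (min r2 r3), by positivity, fun u hu x hx y hy => ?_⟩
    have e1 : ball z (min r1 (min r2 r3)) ⊆ ball z r1 := ball_subset_ball (min_le_left _ _)
    have e2 : ball z (min r1 (min r2 r3)) ⊆ ball z r2 :=
      ball_subset_ball ((min_le_right _ _).trans (min_le_left _ _))
    have e3 : ball z (min r1 (min r2 r3)) ⊆ ball z r3 :=
      ball_subset_ball ((min_le_right _ _).trans (min_le_right _ _))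
    obtain ⟨huU, hu0, huA⟩ := h2 (e2 hu)
    have h3' := h3 (mk_mem_prod (e3 hu) (e3 hx))
    refine ⟨huU, hu0, h3'.le, ?_⟩
    have h4 := h1 (mk_mem_prod (e1 hx) (e1 hy))
    simp only at h4
    have h5 : A * ‖x - y‖ ≤ ‖G x - G y‖ + κ * ‖x - y‖ := by
      rw [← norm_mul]
      calc ‖deriv G z * (x - y)‖ = ‖(G x - G y) - (G x - G y - deriv G z * (x - y))‖ := by
            congr 1; ring
        _ ≤ _ := (norm_sub_le _ _).trans (by gcongr)
    calc ‖deriv G u‖ * ‖x - y‖ ≤ (A + κ) * ‖x - y‖ := by gcongr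
      _ ≤ s * (A - κ) * ‖x - y‖ := by gcongr
      _ = s * (A * ‖x - y‖ - κ * ‖x - y‖) := by ring
      _ ≤ s * ‖G x - G y‖ := by gcongr; linarith
  choose r hr hloc using hloc
  obtain ⟨δ, hδ, h⟩ := lebesgue_number_lemma_of_metric hK (c := fun z : K => ball (z : ℂ) (r z))
    (fun z => isOpen_ball) (fun z hz => mem_iUnion.2 ⟨⟨z, hz⟩, mem_ball_self (hr _)⟩)
  refine ⟨δ, hδ, fun z hz u hu x hx y hy => ?_⟩
  obtain ⟨i, hi⟩ := h z hz
  exact hloc i u (hi hu) x (hi hx) y (hi hy)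

theorem ball_subset_image_of_expansion {G : ℂ → ℂ} (hG : Differentiable ℂ G) {z : ℂ} {δ : ℝ}
    (hδ : 0 < δ) (h : ∀ x ∈ closedBall z δ, ‖x - z‖ ≤ ‖G x - G z‖) :
    ball (G z) (δ / 2) ⊆ G '' closedBall z δ := by
  refine hG.diffContOnCl.ball_subset_image_closedBall hδ (fun x hx => ?_) ?_
  · rw [← mem_sphere_iff_norm.1 hx]
    exact h x (sphere_subset_closedBall hx)
  · have h1 : ∀ᶠ x in 𝓝[≠] z, G x ≠ G z := by
      filter_upwards [self_mem_nhdsWithin, nhdsWithin_le_nhds (closedBall_mem_nhds z hδ)]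
        with x hx hx'
      intro he
      have := h x hx'
      rw [he, sub_self, norm_zero] at this
      exact hx (sub_eq_zero.1 (norm_le_zero_iff.1 this))
    exact h1.frequently.filter_mono nhdsWithin_le_nhds

theorem countable_of_tsum_ne_top {S : Set ℂ} {a : ℂ → ℝ≥0∞} (ha : ∀ z ∈ S, a z ≠ 0)
    (h : ∑' z : S, a z ≠ ∞) : Countable S := by
  have h1 := Summable.countable_support_ennreal h
  have h2 : Function.support (fun z : S => a z) = univ := by
    ext z; simpa using ha z z.2
  rw [h2] at h1
  exact countable_univ_iff.1 h1

theorem dimH_le_of_preimage_sum_le {K U : Set ℂ} (hK : IsCompact K) (hU : IsOpen U) (hKU : K ⊆ U)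
    {G : ℂ → ℂ} (hG : Differentiable ℂ G) (hGK : MapsTo G K K) {c : ℝ} (hc : 1 < c)
    (hexp : ∀ z ∈ K, c ≤ ‖deriv G z‖) (hK0 : (0 : ℂ) ∉ K) {t : ℝ≥0}
    (hsum : ∀ w ∈ K, ∑' z : {z : ℂ | G z = w ∧ z ∈ U},
      (‖w‖ₑ / (‖(z : ℂ)‖ₑ * ‖deriv G z‖ₑ)) ^ (t : ℝ) ≤ 1 / 2) :
    dimH K ≤ t := by
  have ht0 : 0 ≤ (t : ℝ) := t.coe_nonneg
  -- One factor `s` is lost in comparing moduli and one in comparing derivatives; `s < c` keeps the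
  -- contraction.
  obtain ⟨s, hs1, hsc, hst⟩ : ∃ s : ℝ≥0, 1 < s ∧ (s : ℝ) < c ∧ (s ^ 2) ^ (t : ℝ) ≤ (2 : ℝ≥0) := by
    have hcont : Tendsto (fun s : ℝ≥0 => (s ^ 2) ^ (t : ℝ)) (𝓝 1) (𝓝 1) := by
      have h : ContinuousAt (fun s : ℝ≥0 => (s ^ 2) ^ (t : ℝ)) 1 :=
        ContinuousAt.comp (f := fun s : ℝ≥0 => s ^ 2)
          (NNReal.continuousAt_rpow_const (Or.inr ht0)) (by fun_prop)
      simpa [ContinuousAt] using h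
    have h1 := hcont.eventually_le_const (show (1 : ℝ≥0) < 2 by norm_num)
    have h2 : ∀ᶠ s : ℝ≥0 in 𝓝 1, (s : ℝ) < c :=
      (NNReal.continuous_coe.tendsto (1 : ℝ≥0)).eventually_lt_const (by simpa using hc)
    have h3 : ∀ᶠ s : ℝ≥0 in 𝓝[>] 1, 1 < s := self_mem_nhdsWithin
    obtain ⟨s, hs⟩ := (h3.and ((h2.and h1).filter_mono nhdsWithin_le_nhds)).exists
    exact ⟨s, hs.1, hs.2.1, hs.2.2⟩
  have hG0 : ∀ z ∈ K, deriv G z ≠ 0 := fun z hz h0 => by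
    have := hexp z hz
    rw [h0, norm_zero] at this
    linarith
  have hs0 : (0 : ℝ) < s := by have : (1 : ℝ) < s := hs1; linarith
  obtain ⟨δ, hδ, hloc⟩ := exists_local_expansion hK hU hKU hG hG0 hK0 (s := s) hs1
  obtain ⟨M, hM⟩ : ∃ M : ℝ≥0, ∀ z ∈ K, ‖z‖₊ ≤ M := by
    obtain ⟨C, hC⟩ := hK.isBounded.exists_norm_le
    exact ⟨C.toNNReal, fun z hz => NNReal.coe_le_coe.1 ((hC z hz).trans (Real.le_coe_toNNReal C))⟩
  have hcs : (0 : ℝ) < c := by linarith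
  -- The weight `M / ‖w‖ₑ` is the cylindrical density, scaled to be at least `1` on `K`. Since `δ /
  -- 12 < δ / 6`, `w` is in reach of the inverse branches on balls of radius `δ / 3`.
  refine dimH_le_of_hausdorffMeasure_ne_top (hausdorffMeasure_ne_top_of_pullback hK hGK ht0
    (θ := ENNReal.ofReal (s / c)) (d := ENNReal.ofReal (δ / 12)) ?_ ?_ ENNReal.ofReal_ne_top
    (ρ := fun w => M / ‖w‖ₑ) ?_ ?_ ?_)
  · rw [ENNReal.ofReal_lt_one, div_lt_one hcs]
    exact hsc
  · simpa using hδ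
  · intro w hw
    have hw0 : ‖w‖ₑ ≠ 0 := enorm_ne_zero.2 fun h => hK0 (h ▸ hw)
    rw [ENNReal.le_div_iff_mul_le (Or.inl hw0) (Or.inl enorm_ne_top), one_mul]
    exact ENNReal.coe_le_coe.2 (hM w hw)
  · intro w hw
    exact ENNReal.div_ne_top ENNReal.coe_ne_top (enorm_ne_zero.2 fun h => hK0 (h ▸ hw))
  intro E hEK w hw hEd
  have hwK := hEK hw
  have hw0 : ‖w‖ₑ ≠ 0 := enorm_ne_zero.2 fun h => hK0 (h ▸ hwK)
  set P : Set ℂ := {z : ℂ | G z = w ∧ z ∈ U}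
  let F : ℂ → Set ℂ := fun z' => {z ∈ K | G z ∈ E ∧ dist z' z ≤ δ / 3}
  have hcount : Countable P := by
    refine countable_of_tsum_ne_top
      (a := fun z => (‖w‖ₑ / (‖(z : ℂ)‖ₑ * ‖deriv G z‖ₑ)) ^ (t : ℝ)) (fun z _ => ?_)
      (ne_top_of_le_ne_top (by simp) (hsum w hwK))
    simp only [ne_eq, ENNReal.rpow_eq_zero_iff, not_or, not_and_or]
    refine ⟨Or.inl (ENNReal.div_ne_zero.2 ⟨hw0, by finiteness⟩), Or.inr (not_lt.2 ht0)⟩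
  -- Empty pieces are dropped so that each has a base point.
  let ι := {z : P // (F z).Nonempty}
  let b : ι → ℂ := fun i => i.2.some
  have hb : ∀ i : ι, b i ∈ F i.1 := fun i => i.2.some_mem
  have hest : ∀ z' : ℂ, ∀ x ∈ F z', ∀ y ∈ F z',
      ‖deriv G z'‖ₑ * edist x y ≤ s * ediam E ∧ ENNReal.ofReal c * edist x y ≤ s * ediam E ∧
      deriv G z' ≠ 0 ∧ ‖z'‖ₑ ≤ s * ‖x‖ₑ := by
    rintro z' x ⟨hxK, hxE, hx⟩ y ⟨hyK, hyE, hy⟩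
    have hx' : x ∈ ball x δ := mem_ball_self hδ
    have hy' : y ∈ ball x δ := by
      have := dist_triangle_left y x z'
      rw [mem_ball]; linarith
    have hz' : z' ∈ ball x δ := by rw [mem_ball]; linarith
    have hGE : edist (G x) (G y) ≤ ediam E := edist_le_ediam_of_mem hxE hyE
    have conv : ∀ u, ‖deriv G u‖ * ‖x - y‖ ≤ s * ‖G x - G y‖ →
        ‖deriv G u‖ₑ * edist x y ≤ s * ediam E := by
      intro u hu
      refine le_trans ?_ (mul_le_mul_right hGE _)
      rw [edist_eq_enorm_sub, edist_eq_enorm_sub]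
      simp only [enorm_eq_nnnorm]
      exact_mod_cast (show ‖deriv G u‖₊ * ‖x - y‖₊ ≤ s * ‖G x - G y‖₊ from hu)
    obtain ⟨-, h0, h1, h2⟩ := hloc x hxK z' hz' x hx' y hy'
    refine ⟨conv z' h2, ?_, h0, ?_⟩
    · refine le_trans ?_ (conv x (hloc x hxK x hx' x hx' y hy').2.2.2)
      gcongr
      rw [← ofReal_norm]
      exact ENNReal.ofReal_le_ofReal (hexp x hxK)
    · simp only [enorm_eq_nnnorm]
      exact_mod_cast (show ‖z'‖₊ ≤ s * ‖x‖₊ from h1)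
  refine ⟨ι, inferInstance, fun i => F i.1, b, fun i => ⟨hb i, fun z hz => hz.1, ?_⟩, ?_, ?_⟩
  · refine ediam_le fun x hx y hy => ?_
    have h := (hest _ x hx y hy).2.1
    rw [ENNReal.ofReal_div_of_pos hcs, ENNReal.ofReal_coe_nnreal, ENNReal.mul_comm_div,
      ← mul_div_assoc, ENNReal.le_div_iff_mul_le (Or.inl (by simpa using hcs))
      (Or.inl ENNReal.ofReal_ne_top), mul_comm]
    exact h
  · rintro z ⟨hzK, hzE⟩
    have hexpand : ∀ x ∈ closedBall z (δ / 3), ‖x - z‖ ≤ ‖G x - G z‖ := by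
      intro x hx
      have hx' : x ∈ ball z δ := closedBall_subset_ball (by linarith) hx
      have hz' : z ∈ ball z δ := mem_ball_self hδ
      have h := (hloc z hzK z hz' x hx' z hz').2.2.2
      refine le_of_mul_le_mul_left (le_trans ?_ h) hs0
      have := hexp z hzK
      gcongr
      linarith
    have hwball : w ∈ ball (G z) (δ / 3 / 2) := by
      have h : edist w (G z) ≤ ENNReal.ofReal (δ / 12) := (edist_le_ediam_of_mem hw hzE).trans hEd
      rw [edist_dist, ENNReal.ofReal_le_ofReal_iff (by positivity)] at h
      rw [mem_ball]
      linarith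
    obtain ⟨z', hz', hGz'⟩ := ball_subset_image_of_expansion hG (by positivity) hexpand hwball
    have hz'b : z' ∈ ball z δ := closedBall_subset_ball (by linarith) hz'
    have hz'U : z' ∈ U := (hloc z hzK z' hz'b z' hz'b z' hz'b).1
    have hzF : z ∈ F z' := ⟨hzK, hzE, hz'⟩
    exact mem_iUnion.2 ⟨⟨⟨z', hGz', hz'U⟩, ⟨z, hzF⟩⟩, hzF⟩
  · have hterm : ∀ i : ι, (M / ‖b i‖ₑ * ediam (F i.1)) ^ (t : ℝ) ≤
        ((s : ℝ≥0∞) ^ 2) ^ (t : ℝ) * (M / ‖w‖ₑ * ediam E) ^ (t : ℝ) *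
          (‖w‖ₑ / (‖(i.1 : ℂ)‖ₑ * ‖deriv G i.1‖ₑ)) ^ (t : ℝ) := by
      intro i
      have hbi := hb i
      obtain ⟨-, -, hd0, hzb⟩ := hest _ _ hbi _ hbi
      have hd0' : ‖deriv G i.1‖ₑ ≠ 0 := enorm_ne_zero.2 hd0
      have hdiam : ediam (F i.1) ≤ s * ediam E / ‖deriv G i.1‖ₑ := by
        refine ediam_le fun x hx y hy => ?_
        rw [ENNReal.le_div_iff_mul_le (Or.inl hd0') (Or.inl enorm_ne_top), mul_comm]
        exact (hest _ x hx y hy).1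
      have hb0 : ‖b i‖ₑ ≠ 0 := enorm_ne_zero.2 fun h => hK0 (h ▸ hbi.1)
      have hinv : ‖b i‖ₑ⁻¹ ≤ s * ‖(i.1 : ℂ)‖ₑ⁻¹ := by
        rw [← div_eq_mul_inv]
        rw [ENNReal.inv_le_iff_inv_le, ENNReal.inv_div (Or.inl enorm_ne_top) (Or.inr ?_)]
        · exact ENNReal.div_le_of_le_mul' hzb
        · simpa using hs0.ne'
      rw [← ENNReal.mul_rpow_of_nonneg _ _ ht0, ← ENNReal.mul_rpow_of_nonneg _ _ ht0]
      refine ENNReal.rpow_le_rpow ?_ ht0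
      calc M / ‖b i‖ₑ * ediam (F i.1)
          ≤ M * (s * ‖(i.1 : ℂ)‖ₑ⁻¹) * (s * ediam E / ‖deriv G i.1‖ₑ) := by
            rw [div_eq_mul_inv]
            gcongr
        _ = s ^ 2 * (M * ediam E) * (‖(i.1 : ℂ)‖ₑ⁻¹ * ‖deriv G i.1‖ₑ⁻¹) * (‖w‖ₑ⁻¹ * ‖w‖ₑ) := by
            rw [ENNReal.inv_mul_cancel hw0 enorm_ne_top, div_eq_mul_inv]
            ring
        _ = _ := by
            rw [div_eq_mul_inv, div_eq_mul_inv,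
              ENNReal.mul_inv (Or.inr enorm_ne_top) (Or.inl enorm_ne_top)]
            ring
    have hst' : ((s : ℝ≥0∞) ^ 2) ^ (t : ℝ) ≤ 2 := by
      rw [← ENNReal.coe_pow, ← ENNReal.coe_rpow_of_nonneg _ ht0]
      exact_mod_cast hst
    calc _ ≤ ∑' i : ι, ((s : ℝ≥0∞) ^ 2) ^ (t : ℝ) * (M / ‖w‖ₑ * ediam E) ^ (t : ℝ) *
          (‖w‖ₑ / (‖(i.1 : ℂ)‖ₑ * ‖deriv G i.1‖ₑ)) ^ (t : ℝ) := ENNReal.tsum_le_tsum hterm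
      _ = ((s : ℝ≥0∞) ^ 2) ^ (t : ℝ) * (M / ‖w‖ₑ * ediam E) ^ (t : ℝ) *
          ∑' i : ι, (‖w‖ₑ / (‖(i.1 : ℂ)‖ₑ * ‖deriv G i.1‖ₑ)) ^ (t : ℝ) := ENNReal.tsum_mul_left
      _ ≤ 2 * (M / ‖w‖ₑ * ediam E) ^ (t : ℝ) * (1 / 2) := by
        gcongr
        refine le_trans ?_ (hsum w hwK)
        exact ENNReal.tsum_comp_le_tsum_of_injective (f := fun i : ι => i.1) Subtype.val_injective
          (fun z : P => (‖w‖ₑ / (‖(z : ℂ)‖ₑ * ‖deriv G z‖ₑ)) ^ (t : ℝ))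
      _ = (M / ‖w‖ₑ * ediam E) ^ (t : ℝ) := by
        rw [mul_comm, ← mul_assoc, one_div, ENNReal.inv_mul_cancel (by simp) (by simp), one_mul]

/-! ### Partition functions of iterates and of multiples. -/

theorem tsum_iterate_le {g : ℂ → ℂ} (hg : Differentiable ℂ g) {t : ℝ} (ht : 0 ≤ t) {r : ℝ}
    (hr : 0 ≤ r) {q : ℝ≥0∞} (hq : ∀ w : ℂ, r < ‖w‖ → cylPartition t g w ≤ q) (n : ℕ) {w : ℂ}
    (hw : r < ‖w‖) :
    ∑' z : {z : ℂ | g^[n] z = w ∧ ∀ j < n, r < ‖g^[j] z‖},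
      (‖w‖ₑ / (‖(z : ℂ)‖ₑ * ‖deriv g^[n] z‖ₑ)) ^ t ≤ q ^ n := by
  induction n with
  | zero =>
    have hw0 : ‖w‖ₑ ≠ 0 := enorm_ne_zero.2 (norm_pos_iff.1 (hr.trans_lt hw))
    have hset : {z : ℂ | g^[0] z = w ∧ ∀ j < 0, r < ‖g^[j] z‖} = {w} := by
      ext z; simp
    rw [hset, tsum_singleton w fun z => (‖w‖ₑ / (‖z‖ₑ * ‖deriv g^[0] z‖ₑ)) ^ t]
    simp [ENNReal.div_self hw0 enorm_ne_top]
  | succ n ih =>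
    set S := {z : ℂ | g^[n] z = w ∧ ∀ j < n, r < ‖g^[j] z‖}
    have hS : ∀ y ∈ S, r < ‖y‖ := by
      rintro y ⟨hy, hj⟩
      rcases Nat.eq_zero_or_pos n with rfl | hn
      · rw [Function.iterate_zero, id] at hy
        rwa [hy]
      · exact hj 0 hn
    let a : (Σ y : S, g ⁻¹' {(y : ℂ)}) → ℝ≥0∞ := fun p =>
      (‖w‖ₑ / (‖(p.1 : ℂ)‖ₑ * ‖deriv g^[n] p.1‖ₑ)) ^ t *
        (‖(p.1 : ℂ)‖ₑ / (‖(p.2 : ℂ)‖ₑ * ‖deriv g p.2‖ₑ)) ^ t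
    have hmem : ∀ z ∈ {z : ℂ | g^[n + 1] z = w ∧ ∀ j < n + 1, r < ‖g^[j] z‖}, g z ∈ S := by
      rintro z ⟨hz, hj⟩
      refine ⟨by rwa [← Function.iterate_succ_apply], fun j hjn => ?_⟩
      rw [← Function.iterate_succ_apply]
      exact hj _ (by omega)
    -- Preimages are grouped by their first image `g z`.
    let φ : {z : ℂ | g^[n + 1] z = w ∧ ∀ j < n + 1, r < ‖g^[j] z‖} → (Σ y : S, g ⁻¹' {(y : ℂ)}) :=
      fun z => ⟨⟨g z, hmem z z.2⟩, ⟨z, rfl⟩⟩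
    have hφ : Function.Injective φ := by
      intro z z' h
      exact Subtype.ext (congrArg (fun p : (Σ y : S, g ⁻¹' {(y : ℂ)}) => (p.2 : ℂ)) h)
    calc _ ≤ ∑' z, a (φ z) := ENNReal.tsum_le_tsum fun z => ?_
      _ ≤ ∑' p, a p := ENNReal.tsum_comp_le_tsum_of_injective hφ a
      _ = ∑' y : S, (‖w‖ₑ / (‖(y : ℂ)‖ₑ * ‖deriv g^[n] y‖ₑ)) ^ t * cylPartition t g y := by
        rw [ENNReal.tsum_sigma']
        simp only [a, cylPartition, ENNReal.tsum_mul_left]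
      _ ≤ ∑' y : S, (‖w‖ₑ / (‖(y : ℂ)‖ₑ * ‖deriv g^[n] y‖ₑ)) ^ t * q := by
        gcongr with y
        exact hq y (hS y y.2)
      _ ≤ q ^ (n + 1) := by
        rw [ENNReal.tsum_mul_right, pow_succ]
        gcongr
    obtain ⟨z, hz⟩ := z
    have hgz : ‖g z‖ₑ ≠ 0 :=
      enorm_ne_zero.2 (norm_pos_iff.1 (hr.trans_lt (hS _ (hmem z hz))))
    have hchain : deriv g^[n + 1] z = deriv g^[n] (g z) * deriv g z := by
      rw [Function.iterate_succ]
      exact deriv_comp z (hg.iterate n _) (hg z)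
    simp only [a, φ]
    rw [← ENNReal.mul_rpow_of_nonneg _ _ ht]
    refine ENNReal.rpow_le_rpow (le_of_eq ?_) ht
    rw [hchain, enorm_mul, div_eq_mul_inv, div_eq_mul_inv, div_eq_mul_inv,
      ENNReal.mul_inv (Or.inr (by finiteness)) (Or.inl enorm_ne_top),
      ENNReal.mul_inv (Or.inr enorm_ne_top) (Or.inl enorm_ne_top),
      ENNReal.mul_inv (Or.inr enorm_ne_top) (Or.inl enorm_ne_top),
      ENNReal.mul_inv (Or.inr enorm_ne_top) (Or.inl enorm_ne_top)]
    calc _ = ‖w‖ₑ * (‖z‖ₑ⁻¹ * (‖deriv g^[n] (g z)‖ₑ⁻¹ * ‖deriv g z‖ₑ⁻¹)) * 1 := by rw [mul_one]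
      _ = ‖w‖ₑ * (‖z‖ₑ⁻¹ * (‖deriv g^[n] (g z)‖ₑ⁻¹ * ‖deriv g z‖ₑ⁻¹)) * (‖g z‖ₑ * ‖g z‖ₑ⁻¹) := by
        rw [ENNReal.mul_inv_cancel hgz enorm_ne_top]
      _ = _ := by ring

theorem cylPartition_const_mul {c : ℂ} (hc : c ≠ 0) (t : ℝ) (f : ℂ → ℂ) (w : ℂ) :
    cylPartition t (fun z => c * f z) w = cylPartition t f (w / c) := by
  have hset : (fun z => c * f z) ⁻¹' {w} = f ⁻¹' {w / c} := by
    ext z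
    simp [eq_div_iff hc, mul_comm]
  rw [cylPartition, cylPartition, hset]
  refine tsum_congr fun z => ?_
  have h : ‖w‖ₑ = ‖c‖ₑ * ‖w / c‖ₑ := by
    rw [← enorm_mul, mul_div_cancel₀ _ hc]
  rw [deriv_const_mul_field, enorm_mul, h, mul_left_comm,
    ENNReal.mul_div_mul_left _ _ (enorm_ne_zero.2 hc) enorm_ne_top]

/-! ### Hyperbolic sets and the two inequalities. -/

theorem IsHyperbolicSet.one_lt_norm {g : ℂ → ℂ} (hg : Differentiable ℂ g)
    (hg1 : ∀ z : ℂ, ‖z‖ ≤ 1 → ‖g z‖ ≤ 1 / 2) {K : Set ℂ} (hK : IsHyperbolicSet g K) :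
    ∀ z ∈ K, 1 < ‖z‖ := by
  obtain ⟨-, hmaps, n, hn, c, hc, hexp⟩ := hK
  intro z hz
  by_contra! hz1
  have hit : ∀ m : ℕ, ∀ x : ℂ, ‖x‖ ≤ 1 → ‖g^[m + 1] x‖ ≤ 1 / 2 := by
    intro m
    induction m with
    | zero => simpa using hg1
    | succ m ih =>
      intro x hx
      rw [Function.iterate_succ_apply]
      exact ih _ ((hg1 x hx).trans (by norm_num))
  have hy : ‖g z‖ ≤ 1 / 2 := hg1 z hz1
  -- Cauchy's estimate is applied at `g z`, not `z`, so that the circle of radius `1 / 2` stays in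
  -- the unit disc.
  have hd : ‖deriv g^[n] (g z)‖ ≤ (1 / 2) / (1 / 2) := by
    refine Complex.norm_deriv_le_of_forall_mem_sphere_norm_le (by norm_num)
      (hg.iterate n).diffContOnCl fun x hx => ?_
    obtain ⟨m, rfl⟩ := Nat.exists_eq_add_of_le' hn
    refine hit m x ?_
    rw [mem_sphere_iff_norm] at hx
    calc ‖x‖ = ‖(x - g z) + g z‖ := by rw [sub_add_cancel]
      _ ≤ 1 := (norm_add_le _ _).trans (by linarith)
  have := hexp (g z) (hmaps hz)
  linarith

theorem IsHyperbolicSet.dimH_le {g : ℂ → ℂ} (hg : Differentiable ℂ g) {K : Set ℂ}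
    (hK : IsHyperbolicSet g K) {r : ℝ} (hr : 0 ≤ r) (hKr : ∀ z ∈ K, r < ‖z‖) {t : ℝ≥0}
    (ht : ∀ w : ℂ, r < ‖w‖ → cylPartition t g w ≤ 1 / 2) : dimH K ≤ t := by
  obtain ⟨hcpt, hmaps, n, hn, c, hc, hexp⟩ := hK
  have hopen : IsOpen {z : ℂ | ∀ j < n, r < ‖g^[j] z‖} := by
    have h : {z : ℂ | ∀ j < n, r < ‖g^[j] z‖} = ⋂ j ∈ Iio n, {z : ℂ | r < ‖g^[j] z‖} := by
      ext z; simp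
    rw [h]
    exact (finite_Iio n).isOpen_biInter fun j _ =>
      isOpen_lt continuous_const (hg.continuous.iterate j).norm
  refine dimH_le_of_preimage_sum_le hcpt hopen
    (fun z hz j _ => hKr _ (hmaps.iterate j hz)) (hg.iterate n) (hmaps.iterate n) hc hexp
    (fun h0 => ?_) (fun w hw => ?_)
  · have := hKr 0 h0
    rw [norm_zero] at this
    linarith
  · refine (tsum_iterate_le hg t.2 hr ht n (hKr w hw)).trans ?_
    refine (pow_le_pow_right_of_le_one' ?_ hn).trans (pow_one _).le
    rw [one_div]
    exact ENNReal.inv_le_one.2 one_le_two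

theorem exists_forall_cylPartition_le {f : ℂ → ℂ} {t : ℝ≥0}
    (ht : limsup (cylPartition t f) (Bornology.cobounded ℂ) = 0) :
    ∃ R > 0, ∀ w : ℂ, R < ‖w‖ → cylPartition t f w ≤ 1 / 2 := by
  have h : ∀ᶠ w in Bornology.cobounded ℂ, cylPartition t f w < 1 / 2 :=
    eventually_lt_of_limsup_lt (by rw [ht]; simp)
  rw [← comap_norm_atTop] at h
  obtain ⟨R, -, hR⟩ := ((atTop_basis_Ioi (α := ℝ)).comap (norm : ℂ → ℝ)).eventually_iff.1 h
  exact ⟨max R 1, by positivity, fun w hw => (hR ((le_max_left _ _).trans_lt hw)).le⟩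

theorem edimHyp_le_vanishingExponent {f : ℂ → ℂ} (hf : Differentiable ℂ f) :
    edimHyp f ≤ vanishingExponent f := by
  refine le_iInf₂ fun t ht => ?_
  obtain ⟨R, hR, hle⟩ := exists_forall_cylPartition_le ht
  refine limsup_le_of_le (h := ?_)
  filter_upwards [eventually_gt_atTop R] with S hS
  exact iSup₂_le fun K hK =>
    hK.1.dimH_le hf hR.le (fun z hz => hS.trans_le (hK.2 z hz)) hle

theorem limsup_hypdim_le_vanishingExponent {f : ℂ → ℂ} (hf : Differentiable ℂ f) :
    limsup (fun c : ℂ => hypdim (fun z => c * f z)) (𝓝[≠] 0) ≤ vanishingExponent f := by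
  refine le_iInf₂ fun t ht => ?_
  obtain ⟨R, hR, hle⟩ := exists_forall_cylPartition_le ht
  obtain ⟨M, hM⟩ := (isCompact_closedBall (0 : ℂ) 1).exists_bound_of_continuousOn
    hf.continuous.continuousOn
  have hM' : ∀ z : ℂ, ‖z‖ ≤ 1 → ‖f z‖ ≤ M := fun z hz => hM z (by simpa using hz)
  have hsmall : ∀ C : ℝ, ∀ ε > 0, ∀ᶠ c : ℂ in 𝓝[≠] 0, ‖c‖ * C < ε := fun C ε hε => by
    have h : Tendsto (fun c : ℂ => ‖c‖ * C) (𝓝 0) (𝓝 0) := by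
      have hcont : Continuous fun c : ℂ => ‖c‖ * C := by fun_prop
      simpa using hcont.tendsto 0
    exact (h.eventually_lt_const hε).filter_mono nhdsWithin_le_nhds
  refine limsup_le_of_le (h := ?_)
  filter_upwards [self_mem_nhdsWithin, hsmall M (1 / 2) (by norm_num), hsmall R 1 one_pos]
    with c hc hcM hcR
  refine iSup₂_le fun K hK => ?_
  have hg : Differentiable ℂ fun z => c * f z := hf.const_mul c
  have hK1 := hK.one_lt_norm hg fun z hz => by
    rw [norm_mul]
    exact (mul_le_mul_of_nonneg_left (hM' z hz) (norm_nonneg c)).trans hcM.le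
  refine hK.dimH_le hg zero_le_one hK1 fun w hw => ?_
  rw [cylPartition_const_mul hc]
  refine hle _ ?_
  rw [norm_div, lt_div_iff₀ (norm_pos_iff.2 hc), mul_comm]
  exact hcR.trans hw

end EntireDynamics

theorem mainTheorem6 (f : ℂ → ℂ) (hf : EntireDynamics.ClassB f) :
    limsup (fun c : ℂ => EntireDynamics.hypdim (fun z => c * f z)) (𝓝[≠] 0)
        ≤ EntireDynamics.vanishingExponent f ∧
      EntireDynamics.edimHyp f ≤ EntireDynamics.vanishingExponent f :=
  ⟨EntireDynamics.limsup_hypdim_le_vanishingExponent hf.1.1,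
    EntireDynamics.edimHyp_le_vanishingExponent hf.1.1⟩
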